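/- Let $d\ge 2$, let $\mathbb S^d\subset\mathbb R^{d+1}$ be the unit sphere with the surface measure $\sigma$ normalized by $\sigma(\mathbb S^d)=1$, and let $P_n^{(d)}$ be the generalized Legendre polynomial of degree $n$, i.e. $P_n^{(d)}(1)=1$ and the $P_n^{(d)}$ are orthogonal on $[-1,1]$ with respect to the weight $(1-t^2)^{d/2-1}$. For every $C>0$ there is a constant $C_d>0$, depending only on $d$ and $C$, with the following property. Let $K_d$ be a continuous function on $[-1,1]$ given there by $$K_d(t)=\sum_{n=0}^\infty a_nP_n^{(d)}(t),\qquad a_n\ge 0 .$$ Let $\{A_i\}_{i=1}^N$ be an area-regular partition of $\mathbb S^d$, that is, the (measurable) sets $A_i$ are pairwise disjoint, $\mathbb S^d=\bigcup_{i=1}^N A_i$ and $\sigma(A_i)=\frac1N$, and suppose that $\operatorname{diam}(A_i)\le CN^{-1/d}$ for $i=1,\dots,N$ (Euclidean distance). Let $\sigma_i^*(\cdot)=N\,\sigma(A_i\cap\cdot)$ be the uniform distribution on $A_i$, and let $$E(K_d,X_N)=\frac1{N^2}\sum_{i,j=1}^N K_d(\langle \mathbf x_i,\mathbf x_j\rangle),\qquad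 X_N=\{\mathbf x_1,\dots,\mathbf x_N\}.$$ Then $\sum_n a_n<\infty$, the energy is integrable, and $$\int_{A_1}\!\cdots\!\int_{A_N}E(K_d,X_N)\,d\sigma_1^*(\mathbf x_1)\cdots d\sigma_N^*(\mathbf x_N)-a_0\le\frac{C_d}{N}\Bigg(N^{-2/d}\sum_{n=1}^{[N^{1/d}]}a_nn^2+\sum_{n=[N^{1/d}]+1}^\infty a_n\Bigg),$$ where $[\cdot]$ denotes the integer part. -/

import Mathlib

open scoped ENNReal

/-- The generalized Legendre polynomials `P_n^{(d)}` through their three-term recurrence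
`(n + d) P_{n+2} = (2n + d + 1) X P_{n+1} - (n + 1) P_n`, `P_0 = 1`, `P_1 = X`.
That this is the family with `deg P_n = n`, `P_n(1) = 1`, orthogonal on `[-1,1]` with respect to the
weight `(1 - t^2)^(d/2 - 1)` is `genLegendre_isGenLegendreFamily` below. -/
noncomputable def genLegendre (d : ℕ) : ℕ → Polynomial ℝ
  | 0 => 1
  | 1 => Polynomial.X
  | n + 2 => Polynomial.C (1 / ((n : ℝ) + d)) *
      (Polynomial.C (2 * (n : ℝ) + d + 1) * Polynomial.X * genLegendre d (n + 1)
        - Polynomial.C ((n : ℝ) + 1) * genLegendre d n)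

/-- The defining properties of the generalized Legendre polynomials: exact degree `n`,
normalization at `1`, orthogonality on `[-1,1]` with weight `(1 - t^2)^(d/2 - 1)`. -/
def IsGenLegendreFamily (d : ℕ) (P : ℕ → Polynomial ℝ) : Prop :=
  (∀ n, (P n).natDegree = n) ∧ (∀ n, (P n).eval 1 = 1) ∧
  ∀ m n, m ≠ n →
    ∫ t in (-1 : ℝ)..1, (P m).eval t * (P n).eval t * (1 - t ^ 2) ^ ((d : ℝ) / 2 - 1) = 0

section GenLegendreFacts

open Polynomial

theorem genLegendre_rec {d : ℕ} (hd : 2 ≤ d) (n : ℕ) :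
    C ((n : ℝ) + d) * genLegendre d (n + 2) =
      C (2 * (n : ℝ) + d + 1) * X * genLegendre d (n + 1) - C ((n : ℝ) + 1) * genLegendre d n := by
  have h0 : ((n : ℝ) + d) ≠ 0 := by positivity
  rw [genLegendre, ← mul_assoc, ← C_mul, mul_one_div_cancel h0, C_1, one_mul]

theorem genLegendre_eval_one {d : ℕ} (hd : 2 ≤ d) (n : ℕ) : (genLegendre d n).eval 1 = 1 := by
  induction n using Nat.strong_induction_on with
  | _ n ih =>
    match n with
    | 0 => simp [genLegendre]
    | 1 => simp [genLegendre]
    | n + 2 =>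
      have h := congrArg (eval 1) (genLegendre_rec hd n)
      have h0 : ((n : ℝ) + d) ≠ 0 := by positivity
      simp only [eval_mul, eval_sub, eval_C, eval_X, ih (n + 1) (by omega), ih n (by omega)] at h
      apply mul_left_cancel₀ h0
      linarith

theorem genLegendre_natDegree_aux {d : ℕ} (hd : 2 ≤ d) (n : ℕ) :
    (genLegendre d n).natDegree ≤ n ∧ 0 < (genLegendre d n).coeff n := by
  induction n using Nat.strong_induction_on with
  | _ n ih =>
    match n with
    | 0 => simp [genLegendre]
    | 1 => simp [genLegendre]
    | n + 2 =>
      obtain ⟨h1, h1'⟩ := ih (n + 1) (by omega)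
      obtain ⟨h2, -⟩ := ih n (by omega)
      have hz : (genLegendre d n).coeff (n + 2) = 0 :=
        coeff_eq_zero_of_natDegree_lt (by omega)
      constructor
      · rw [natDegree_le_iff_coeff_eq_zero]
        intro k hk
        obtain ⟨k, rfl⟩ : ∃ j, k = j + 1 := ⟨k - 1, by omega⟩
        rw [genLegendre, coeff_C_mul, coeff_sub, mul_assoc, coeff_C_mul, coeff_C_mul, coeff_X_mul,
          coeff_eq_zero_of_natDegree_lt (p := genLegendre d (n + 1)) (by omega),
          coeff_eq_zero_of_natDegree_lt (p := genLegendre d n) (by omega)]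
        simp
      · rw [genLegendre, coeff_C_mul, coeff_sub, mul_assoc, coeff_C_mul, coeff_C_mul, coeff_X_mul,
          hz]
        simp only [mul_zero, sub_zero]
        positivity

theorem genLegendre_deriv {d : ℕ} (hd : 2 ≤ d) (n : ℕ) :
    (1 - X ^ 2) * derivative (genLegendre d n) =
        C ((n : ℝ) + d - 1) * (X * genLegendre d n - genLegendre d (n + 1)) ∧
      (1 - X ^ 2) * derivative (genLegendre d (n + 1)) =
        C ((n : ℝ) + 1) * (genLegendre d n - X * genLegendre d (n + 1)) := by
  induction n with
  | zero => constructor <;> simp [genLegendre] <;> ring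
  | succ n ih =>
    obtain ⟨hB, hA⟩ := ih
    have hr := genLegendre_rec hd n
    have hd' := congrArg derivative hr
    have h0 : (C ((n : ℝ) + d)) ≠ 0 := by
      rw [Ne, C_eq_zero]; positivity
    simp only [derivative_mul, derivative_sub, derivative_C, derivative_X, zero_mul, zero_add,
      mul_one] at hd'
    constructor
    · rw [hA]
      push_cast at *
      simp only [C_add, C_sub, C_mul, C_1, map_natCast, map_ofNat] at *
      linear_combination hr
    · apply mul_left_cancel₀ h0
      push_cast at *
      simp only [C_add, C_sub, C_mul, C_1, map_natCast, map_ofNat] at *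
      linear_combination (1 - X ^ 2) * hd' + (2 * (n : ℝ[X]) + d + 1) * X * hA
        - ((n : ℝ[X]) + 1) * hB + ((n : ℝ[X]) + 2) * X * hr

theorem genLegendre_ode {d : ℕ} (hd : 2 ≤ d) (n : ℕ) :
    (1 - X ^ 2) * derivative (derivative (genLegendre d n))
      - C (d : ℝ) * X * derivative (genLegendre d n)
      + C ((n : ℝ) * ((n : ℝ) + d - 1)) * genLegendre d n = 0 := by
  cases n with
  | zero => simp [genLegendre]
  | succ n =>
    obtain ⟨hB, hA⟩ := genLegendre_deriv hd n
    have hw : (1 - X ^ 2 : ℝ[X]) ≠ 0 := by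
      intro h
      have := congrArg (eval 0) h
      simp at this
    have hA' := congrArg derivative hA
    simp only [derivative_mul, derivative_sub, derivative_C, derivative_X, zero_mul, zero_add,
      derivative_one, derivative_X_pow, one_mul] at hA'
    apply mul_left_cancel₀ hw
    push_cast at *
    simp only [C_add, C_sub, C_mul, C_1, map_natCast, map_ofNat] at *
    linear_combination (1 - X ^ 2) * hA' + ((n : ℝ[X]) + 1) * hB
      + (1 - d - n) * X * hA

theorem genLegendre_isGenLegendreFamily {d : ℕ} (hd : 2 ≤ d) :
    IsGenLegendreFamily d (genLegendre d) := by
  refine ⟨fun n => ?_, genLegendre_eval_one hd, fun m n hmn => ?_⟩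
  · obtain ⟨h1, h2⟩ := genLegendre_natDegree_aux hd n
    exact le_antisymm h1 (le_natDegree_of_ne_zero h2.ne')
  · set p := genLegendre d m
    set q := genLegendre d n
    have hd2 : (1 : ℝ) ≤ (d : ℝ) / 2 := by
      have : (2 : ℝ) ≤ d := by exact_mod_cast hd
      linarith
    have hl : (m : ℝ) * ((m : ℝ) + d - 1) - (n : ℝ) * ((n : ℝ) + d - 1) ≠ 0 := by
      have h1 : (m : ℝ) - n ≠ 0 := sub_ne_zero.2 (by exact_mod_cast hmn)
      have h2 : (m : ℝ) + n + d - 1 ≠ 0 := by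
        have : (0 : ℝ) ≤ m + n := by positivity
        intro h
        linarith
      intro h
      apply mul_ne_zero h1 h2
      linear_combination h
    have hderiv : ∀ t ∈ Set.uIcc (-1 : ℝ) 1,
        HasDerivAt (fun t : ℝ => (1 - t ^ 2) ^ ((d : ℝ) / 2) *
            ((derivative q).eval t * p.eval t - (derivative p).eval t * q.eval t))
          (((m : ℝ) * ((m : ℝ) + d - 1) - (n : ℝ) * ((n : ℝ) + d - 1)) *
            (p.eval t * q.eval t * (1 - t ^ 2) ^ ((d : ℝ) / 2 - 1))) t := by
      intro t ht
      rw [Set.uIcc_of_le (by norm_num)] at ht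
      have hw : (0 : ℝ) ≤ 1 - t ^ 2 := by nlinarith [ht.1, ht.2]
      have hpow : (1 - t ^ 2) ^ ((d : ℝ) / 2) = (1 - t ^ 2) * (1 - t ^ 2) ^ ((d : ℝ) / 2 - 1) := by
        rw [← Real.rpow_one_add' hw (by linarith)]
        congr 1
        ring
      have hb : HasDerivAt (fun t : ℝ => 1 - t ^ 2) (-(2 * t)) t := by
        simpa using ((hasDerivAt_id t).pow 2).const_sub 1
      have h1 := hb.rpow_const (p := (d : ℝ) / 2) (Or.inr hd2)
      have h2 := ((derivative q).hasDerivAt t).mul (p.hasDerivAt t)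
      have h3 := ((derivative p).hasDerivAt t).mul (q.hasDerivAt t)
      have ep := congrArg (eval t) (genLegendre_ode hd m)
      have eq := congrArg (eval t) (genLegendre_ode hd n)
      simp only [eval_add, eval_sub, eval_mul, eval_C, eval_X, eval_one, eval_pow, eval_zero]
        at ep eq
      refine (h1.mul (h2.sub h3)).congr_deriv ?_
      simp only [Pi.sub_apply, Pi.mul_apply]
      rw [hpow]
      linear_combination (1 - t ^ 2) ^ ((d : ℝ) / 2 - 1) * (p.eval t * eq - q.eval t * ep)
    have hcont : Continuous fun t : ℝ =>
        (((m : ℝ) * ((m : ℝ) + d - 1) - (n : ℝ) * ((n : ℝ) + d - 1)) *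
            (p.eval t * q.eval t * (1 - t ^ 2) ^ ((d : ℝ) / 2 - 1))) := by
      have hr : Continuous fun t : ℝ => (1 - t ^ 2) ^ ((d : ℝ) / 2 - 1) :=
        (by fun_prop : Continuous fun t : ℝ => 1 - t ^ 2).rpow_const
          (fun _ => Or.inr (by linarith))
      exact continuous_const.mul ((p.continuous.mul q.continuous).mul hr)
    have hF := intervalIntegral.integral_eq_sub_of_hasDerivAt hderiv
      (hcont.intervalIntegrable _ _)
    rw [intervalIntegral.integral_const_mul] at hF
    have h0 : (0 : ℝ) ^ ((d : ℝ) / 2) = 0 := Real.zero_rpow (by linarith)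
    norm_num [h0] at hF
    rcases hF with hF | hF
    · exact absurd hF hl
    · exact hF

end GenLegendreFacts

/-- The unit sphere `S^d` in `ℝ^(d+1)`, with the chordal (Euclidean) distance. -/
abbrev USphere (d : ℕ) : Type := Metric.sphere (0 : EuclideanSpace ℝ (Fin (d + 1))) 1

/-- The surface measure on `S^d`, normalized to total mass one. -/
noncomputable def sphereSigma (d : ℕ) : MeasureTheory.Measure (USphere d) :=
  ((MeasureTheory.volume : MeasureTheory.Measure
      (EuclideanSpace ℝ (Fin (d + 1)))).toSphere Set.univ)⁻¹ •
    (MeasureTheory.volume : MeasureTheory.Measure (EuclideanSpace ℝ (Fin (d + 1)))).toSphere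

instance sphereSigma_isProbabilityMeasure (d : ℕ) :
    MeasureTheory.IsProbabilityMeasure (sphereSigma d) := by
  constructor
  rw [sphereSigma, MeasureTheory.Measure.smul_apply, smul_eq_mul]
  apply ENNReal.inv_mul_cancel
  · rw [MeasureTheory.Measure.toSphere_apply_univ]
    refine mul_ne_zero (by simp) ?_
    exact (Metric.measure_ball_pos _ _ one_pos).ne'
  · exact MeasureTheory.measure_ne_top _ _

/-- An area-regular partition of `S^d` into `N` regions. -/
structure IsAreaRegularPartition (d N : ℕ) (A : Fin N → Set (USphere d)) : Prop where
  measurable : ∀ i, MeasurableSet (A i)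
  covers : ⋃ i, A i = Set.univ
  disjoint : ∀ i j, i ≠ j → A i ∩ A j = ∅
  area : ∀ i, sphereSigma d (A i) = (N : ℝ≥0∞)⁻¹

/-- The uniform distribution `σ_i^*(B) = N σ(A_i ∩ B)` on a region of area `1/N`. -/
noncomputable def regionMeasure (d N : ℕ) (Ai : Set (USphere d)) :
    MeasureTheory.Measure (USphere d) :=
  (N : ℝ≥0∞) • (sphereSigma d).restrict Ai

/-- The normalized energy `E(K, X_N) = N⁻² ∑_{i,j} K(⟨x_i, x_j⟩)`, diagonal included. -/
noncomputable def energy (d N : ℕ) (K : ℝ → ℝ) (x : Fin N → USphere d) : ℝ :=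
  1 / (N : ℝ) ^ 2 * ∑ i, ∑ j,
    K (inner ℝ (x i : EuclideanSpace ℝ (Fin (d + 1))) (x j : EuclideanSpace ℝ (Fin (d + 1))))

/-- The law of a jittered sample: independent points, the `i`-th one uniform in `A i`. -/
noncomputable def jitteredLaw (d N : ℕ) (A : Fin N → Set (USphere d)) :
    MeasureTheory.Measure (Fin N → USphere d) :=
  MeasureTheory.Measure.pi fun i => regionMeasure d N (A i)

/-! Distinct sample points are independent, so the pair `i ≠ j` contributes the double integral of
`K` against σ_i^* ⊗ σ_j^*. If the diagonal pairs contributed likewise, the mean energy would be ∫∫ K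
dσ dσ = a_0, because the regions tile the sphere with equal weights. On the diagonal K(1) stands in
place of the mean of `K` over A_i × A_i, so the excess over a_0 is at most 1/N times the oscillation
of `K` near the diagonal (`kernel_one_sub_le`).

That oscillation is Σ a_n (1 - P_n(t)) with 1 - t = |x - y|²/2 = O(N^(-2/d)). Degrees up to
[N^(1/d)] use 1 - P_n(t) ≤ n²(1 - t), a consequence of |P_n'| ≤ n²; higher degrees use |P_n| ≤ 1.
Both bounds come from the differential equation through Sonin's argument. The value a_0 requires P_n
to have mean zero for n ≥ 1 (`integral_genLegendre_inner`): P_n is an eigenfunction of the zonal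
Laplacian, whose mean vanishes by a moment recurrence derived from Gaussian integrals. -/

/-! ### Bounds for the Legendre polynomials and their derivatives on [-1, 1]. -/

section LegendreBounds

open Polynomial

/-- Sonin's bound: a polynomial solution of `(1 - t²) p'' - c t p' + μ p = 0` with `c ≥ 1` and
`μ > 0` is bounded on `[-1, 1]` by its values at the end points. -/
theorem sq_eval_le_of_gegenbauer_ode {p : ℝ[X]} {c μ B : ℝ} (hc : 1 ≤ c) (hμ : 0 < μ)
    (hode : ∀ t, (1 - t ^ 2) * (derivative (derivative p)).eval t
      - c * t * (derivative p).eval t + μ * p.eval t = 0)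
    (h1 : (p.eval 1) ^ 2 ≤ B) (h2 : (p.eval (-1)) ^ 2 ≤ B) {t : ℝ} (ht : t ∈ Set.Icc (-1 : ℝ) 1) :
    (p.eval t) ^ 2 ≤ B := by
  -- Sonin's function dominates p² on [-1, 1] and agrees with it at ±1. By the equation its
  -- derivative has the sign of t, so its maximum is at an end point.
  set f : ℝ → ℝ := fun t => (p.eval t) ^ 2 + (1 - t ^ 2) * ((derivative p).eval t) ^ 2 / μ with hf
  have hderiv : ∀ t, HasDerivAt f (2 * (c - 1) * t * ((derivative p).eval t) ^ 2 / μ) t := by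
    intro t
    have hb : HasDerivAt (fun t : ℝ => 1 - t ^ 2) (-(2 * t)) t := by
      simpa using ((hasDerivAt_id t).pow 2).const_sub 1
    have h := ((p.hasDerivAt t).pow 2).add
      ((hb.mul (((derivative p).hasDerivAt t).pow 2)).div_const μ)
    refine h.congr_deriv ?_
    simp only [Pi.pow_apply]
    field_simp
    push_cast
    linear_combination 2 * eval t (derivative p) * hode t
  have hcont : Continuous f := continuous_iff_continuousAt.2 fun t => (hderiv t).continuousAt
  have hle : (p.eval t) ^ 2 ≤ f t := by
    have : 0 ≤ (1 - t ^ 2) * ((derivative p).eval t) ^ 2 / μ :=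
      div_nonneg (mul_nonneg (by nlinarith [ht.1, ht.2]) (sq_nonneg _)) hμ.le
    simp only [hf]
    linarith
  refine hle.trans ?_
  rcases le_total 0 t with h0 | h0
  · have hm : MonotoneOn f (Set.Icc 0 1) := by
      refine monotoneOn_of_deriv_nonneg (convex_Icc _ _) hcont.continuousOn
        (fun x _ => (hderiv x).differentiableAt.differentiableWithinAt) fun x hx => ?_
      rw [interior_Icc] at hx
      rw [(hderiv x).deriv]
      have := hx.1
      have : 0 ≤ c - 1 := by linarith
      positivity
    refine (hm ⟨h0, ht.2⟩ ⟨zero_le_one, le_rfl⟩ ht.2).trans ?_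
    simpa [hf] using h1
  · have hm : AntitoneOn f (Set.Icc (-1) 0) := by
      refine antitoneOn_of_deriv_nonpos (convex_Icc _ _) hcont.continuousOn
        (fun x _ => (hderiv x).differentiableAt.differentiableWithinAt) fun x hx => ?_
      rw [interior_Icc] at hx
      rw [(hderiv x).deriv]
      have h3 := hx.2
      have h4 : 0 ≤ c - 1 := by linarith
      refine div_nonpos_of_nonpos_of_nonneg (mul_nonpos_of_nonpos_of_nonneg ?_ (sq_nonneg _)) hμ.le
      nlinarith
    refine (hm ⟨le_rfl, by norm_num⟩ ⟨ht.1, h0⟩ ht.1).trans ?_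
    simpa [hf] using h2

theorem genLegendre_eval_ode {d : ℕ} (hd : 2 ≤ d) (n : ℕ) (t : ℝ) :
    (1 - t ^ 2) * (derivative (derivative (genLegendre d n))).eval t
      - d * t * (derivative (genLegendre d n)).eval t
      + (n : ℝ) * ((n : ℝ) + d - 1) * (genLegendre d n).eval t = 0 := by
  simpa using congrArg (eval t) (genLegendre_ode hd n)

theorem genLegendre_eval_neg_one {d : ℕ} (hd : 2 ≤ d) (n : ℕ) :
    (genLegendre d n).eval (-1) = (-1) ^ n := by
  induction n using Nat.strong_induction_on with
  | _ n ih =>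
    match n with
    | 0 => simp [genLegendre]
    | 1 => simp [genLegendre]
    | n + 2 =>
      have h := congrArg (eval (-1)) (genLegendre_rec hd n)
      have h0 : ((n : ℝ) + d) ≠ 0 := by positivity
      simp only [eval_mul, eval_sub, eval_C, eval_X, ih (n + 1) (by omega), ih n (by omega)] at h
      apply mul_left_cancel₀ h0
      rw [h]
      ring

theorem genLegendre_eigenvalue_pos {d n : ℕ} (hd : 2 ≤ d) (hn : 1 ≤ n) :
    0 < (n : ℝ) * ((n : ℝ) + d - 1) := by
  have h1 : (1 : ℝ) ≤ n := by exact_mod_cast hn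
  have h2 : (2 : ℝ) ≤ d := by exact_mod_cast hd
  exact mul_pos (by linarith) (by linarith)

theorem abs_genLegendre_eval_le_one {d : ℕ} (hd : 2 ≤ d) (n : ℕ) {t : ℝ}
    (ht : t ∈ Set.Icc (-1 : ℝ) 1) : |(genLegendre d n).eval t| ≤ 1 := by
  rcases Nat.eq_zero_or_pos n with rfl | hn
  · simp [genLegendre]
  · have h2 : (1 : ℝ) ≤ d := by exact_mod_cast (by omega : 1 ≤ d)
    rw [← sq_le_one_iff_abs_le_one]
    refine sq_eval_le_of_gegenbauer_ode h2 (genLegendre_eigenvalue_pos hd hn)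
      (genLegendre_eval_ode hd n) ?_ ?_ ht
    · simp [genLegendre_eval_one hd]
    · rw [genLegendre_eval_neg_one hd, ← pow_mul, mul_comm, pow_mul]
      simp

/-- Differentiating the equation shows that P_n' solves one of the same type, with c = d + 2 and μ =
n(n + d - 1) - d. Since μ > 0 only for n ≥ 2, degrees 0 and 1 are separate. At ±1 the second-order
term drops out, leaving d |P_n'(±1)| = n(n + d - 1) ≤ d n². -/
theorem abs_derivative_genLegendre_eval_le {d : ℕ} (hd : 2 ≤ d) (n : ℕ) {t : ℝ}
    (ht : t ∈ Set.Icc (-1 : ℝ) 1) :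
    |(derivative (genLegendre d n)).eval t| ≤ (n : ℝ) ^ 2 := by
  match n with
  | 0 => simp [genLegendre]
  | 1 => simp [genLegendre]
  | n + 2 =>
    set m := n + 2 with hm
    have hm2 : (2 : ℝ) ≤ m := by exact_mod_cast (by omega : 2 ≤ m)
    have hd2 : (2 : ℝ) ≤ d := by exact_mod_cast hd
    set q := derivative (genLegendre d m) with hq
    have hB : ((m : ℝ) * (m + d - 1)) ^ 2 ≤ (d * (m : ℝ) ^ 2) ^ 2 := by
      have : (m : ℝ) * (m + d - 1) ≤ d * (m : ℝ) ^ 2 := by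
        nlinarith [mul_nonneg (mul_nonneg (by linarith : (0 : ℝ) ≤ m)
          (by linarith : (0 : ℝ) ≤ d - 1)) (by linarith : (0 : ℝ) ≤ m - 1)]
      have h0 := (genLegendre_eigenvalue_pos hd (n := m) (by omega)).le
      exact pow_le_pow_left₀ h0 this 2
    have hpos : (0 : ℝ) < (d : ℝ) ^ 2 := by positivity
    have hodeq : ∀ t : ℝ, (1 - t ^ 2) * (derivative (derivative q)).eval t
        - (d + 2) * t * (derivative q).eval t + (m * (m + d - 1) - d) * q.eval t = 0 := by
      intro t
      have h := congrArg (fun p => eval t (derivative p)) (genLegendre_ode hd m)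
      simp only [derivative_mul, derivative_add, derivative_sub, derivative_C, derivative_X,
        derivative_one, derivative_X_pow, derivative_zero, eval_add, eval_sub, eval_mul, eval_C,
        eval_X, eval_one, eval_pow, eval_zero, ← hq] at h
      norm_num at h
      linear_combination h
    refine abs_le_of_sq_le_sq ?_ (by positivity)
    refine sq_eval_le_of_gegenbauer_ode (by linarith) (by nlinarith) hodeq ?_ ?_ ht
    · have h := genLegendre_eval_ode hd m 1
      rw [genLegendre_eval_one hd, ← hq] at h
      have h' : (d : ℝ) * q.eval 1 = m * (m + d - 1) := by linear_combination -h
      rw [← h', mul_pow, mul_pow] at hB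
      exact le_of_mul_le_mul_left hB hpos
    · have h := genLegendre_eval_ode hd m (-1)
      rw [genLegendre_eval_neg_one hd, ← hq] at h
      have h' : (d : ℝ) * q.eval (-1) = -(m * (m + d - 1) * (-1) ^ m) := by linear_combination h
      have h'' := congrArg (· ^ 2) h'
      have hs : ((-1 : ℝ) ^ m) ^ 2 = 1 := by rw [← pow_mul, mul_comm, pow_mul]; simp
      simp only [neg_sq, mul_pow _ ((-1 : ℝ) ^ m), hs, mul_one] at h''
      rw [← h'', mul_pow, mul_pow] at hB
      exact le_of_mul_le_mul_left hB hpos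

theorem one_sub_genLegendre_eval_le {d : ℕ} (hd : 2 ≤ d) (n : ℕ) {t : ℝ}
    (ht : t ∈ Set.Icc (-1 : ℝ) 1) :
    1 - (genLegendre d n).eval t ≤ (n : ℝ) ^ 2 * (1 - t) := by
  have h := (convex_Icc (-1 : ℝ) 1).norm_image_sub_le_of_norm_hasDerivWithin_le
    (f := fun t => (genLegendre d n).eval t) (f' := fun t => (derivative (genLegendre d n)).eval t)
    (fun x _ => ((genLegendre d n).hasDerivAt x).hasDerivWithinAt)
    (fun x hx => abs_derivative_genLegendre_eval_le hd n hx) ht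
    (Set.right_mem_Icc.2 (by norm_num))
  simp only [genLegendre_eval_one hd, Real.norm_eq_abs] at h
  rw [abs_of_nonneg (by linarith [ht.2] : 0 ≤ 1 - t)] at h
  exact (le_abs_self _).trans h

end LegendreBounds

/-! ### Moments of the sphere from Gaussian integrals. -/

section SphericalMoments

open MeasureTheory Set

theorem finrank_ambient (d : ℕ) : Module.finrank ℝ (EuclideanSpace ℝ (Fin (d + 1))) = d + 1 := by
  simp

theorem integrableOn_pow_mul_exp_neg_sq (k : ℕ) :
    IntegrableOn (fun r : ℝ => r ^ k * Real.exp (-r ^ 2)) (Ioi 0) := by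
  have h := integrableOn_rpow_mul_exp_neg_mul_sq (b := 1) one_pos (s := k)
    (by have : (0 : ℝ) ≤ k := k.cast_nonneg
        linarith)
  simpa [Real.rpow_natCast] using h

theorem integral_pow_mul_exp_neg_sq (k : ℕ) :
    ∫ r in Ioi (0 : ℝ), r ^ k * Real.exp (-r ^ 2) = 1 / 2 * Real.Gamma (((k : ℝ) + 1) / 2) := by
  have h := integral_rpow_mul_exp_neg_rpow (p := 2) (q := k) two_pos
    (by have : (0 : ℝ) ≤ k := k.cast_nonneg
        linarith)
  simpa [Real.rpow_natCast] using h

/-- Γ(s + 1) = s Γ(s). This ratio removes the radial factors when Gaussian moments are turned into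
spherical ones. -/
theorem integral_pow_add_two_mul_exp_neg_sq (k : ℕ) :
    ∫ r in Ioi (0 : ℝ), r ^ (k + 2) * Real.exp (-r ^ 2) =
      ((k : ℝ) + 1) / 2 * ∫ r in Ioi (0 : ℝ), r ^ k * Real.exp (-r ^ 2) := by
  rw [integral_pow_mul_exp_neg_sq, integral_pow_mul_exp_neg_sq]
  have h : (((k + 2 : ℕ) : ℝ) + 1) / 2 = ((k : ℝ) + 1) / 2 + 1 := by push_cast; ring
  rw [h, Real.Gamma_add_one (by positivity)]
  ring

theorem integrable_inner_pow_mul_gaussian {d : ℕ} (y : EuclideanSpace ℝ (Fin (d + 1))) (k : ℕ) :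
    Integrable fun x : EuclideanSpace ℝ (Fin (d + 1)) =>
      (inner ℝ x y) ^ k * Real.exp (-‖x‖ ^ 2) := by
  have h : Integrable fun x : EuclideanSpace ℝ (Fin (d + 1)) =>
      ‖y‖ ^ k * (‖x‖ ^ k * Real.exp (-‖x‖ ^ 2)) := by
    refine Integrable.const_mul ?_ _
    rw [integrable_fun_norm_addHaar (f := fun r : ℝ => r ^ k * Real.exp (-r ^ 2)) volume,
      finrank_ambient]
    refine (integrableOn_pow_mul_exp_neg_sq (d + k)).congr_fun (fun r _ => ?_) measurableSet_Ioi
    simp only [add_tsub_cancel_right, smul_eq_mul, pow_add, mul_assoc]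
  refine h.mono' (Continuous.aestronglyMeasurable (by fun_prop)) (Filter.Eventually.of_forall ?_)
  intro x
  rw [norm_mul, norm_pow, Real.norm_eq_abs, Real.norm_eq_abs, Real.abs_exp, ← mul_assoc,
    ← mul_pow, mul_comm ‖y‖]
  gcongr
  exact abs_real_inner_le_norm x y

/-- Polar coordinates for the Gaussian moments. -/
theorem integral_inner_pow_mul_gaussian {d : ℕ} (y : EuclideanSpace ℝ (Fin (d + 1))) (k : ℕ) :
    ∫ x : EuclideanSpace ℝ (Fin (d + 1)), (inner ℝ x y) ^ k * Real.exp (-‖x‖ ^ 2) =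
      (∫ u : USphere d, (inner ℝ (u : EuclideanSpace ℝ (Fin (d + 1))) y) ^ k
        ∂(volume : Measure (EuclideanSpace ℝ (Fin (d + 1)))).toSphere) *
      ∫ r in Ioi (0 : ℝ), r ^ (d + k) * Real.exp (-r ^ 2) := by
  set f : EuclideanSpace ℝ (Fin (d + 1)) → ℝ :=
    fun x => (inner ℝ x y) ^ k * Real.exp (-‖x‖ ^ 2) with hf
  calc ∫ x : EuclideanSpace ℝ (Fin (d + 1)), f x =
        ∫ x : ({(0)}ᶜ : Set (EuclideanSpace ℝ (Fin (d + 1)))), f x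
          ∂((volume : Measure (EuclideanSpace ℝ (Fin (d + 1)))).comap (↑)) := by
        rw [integral_subtype_comap (measurableSet_singleton _).compl f,
          restrict_compl_singleton]
    _ = ∫ p : USphere d × Ioi (0 : ℝ),
          (inner ℝ (p.1 : EuclideanSpace ℝ (Fin (d + 1))) y) ^ k *
            ((p.2 : ℝ) ^ k * Real.exp (-(p.2 : ℝ) ^ 2))
          ∂((volume : Measure (EuclideanSpace ℝ (Fin (d + 1)))).toSphere.prod
            (Measure.volumeIoiPow (Module.finrank ℝ (EuclideanSpace ℝ (Fin (d + 1))) - 1))) := by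
        rw [← (Measure.measurePreserving_homeomorphUnitSphereProd
          (volume : Measure (EuclideanSpace ℝ (Fin (d + 1))))).integral_comp
          (Homeomorph.measurableEmbedding _)]
        refine integral_congr_ae (Filter.Eventually.of_forall fun x => ?_)
        have hx : ‖(x : EuclideanSpace ℝ (Fin (d + 1)))‖ ≠ 0 := norm_ne_zero_iff.2 x.2
        simp only [homeomorphUnitSphereProd_apply_snd_coe, homeomorphUnitSphereProd_apply_fst_coe,
          hf, inner_smul_left, mul_pow]
        simp
        field_simp
    _ = _ := by
        rw [integral_prod_mul
          (fun u : USphere d => (inner ℝ (u : EuclideanSpace ℝ (Fin (d + 1))) y) ^ k)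
          (fun r : Ioi (0 : ℝ) => (r : ℝ) ^ k * Real.exp (-(r : ℝ) ^ 2))]
        congr 1
        -- The radial measure has density r^d, which combines with r^k to give the exponent d + k.
        rw [Measure.volumeIoiPow, integral_withDensity_eq_integral_toReal_smul
          (by fun_prop) (by simp), integral_subtype_comap measurableSet_Ioi
            (fun a : ℝ =>
              (ENNReal.ofReal (a ^ (Module.finrank ℝ (EuclideanSpace ℝ (Fin (d + 1))) - 1))).toReal •
              (a ^ k * Real.exp (-a ^ 2)))]
        refine setIntegral_congr_fun measurableSet_Ioi fun r hr => ?_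
        have hr : 0 < r := hr
        simp only [finrank_ambient, add_tsub_cancel_right, smul_eq_mul]
        rw [ENNReal.toReal_ofReal (by positivity), pow_add, mul_assoc]

/-- Integration by parts for the Gaussian weight. -/
theorem two_mul_integral_inner_pow_succ_mul_gaussian {d : ℕ} {y : EuclideanSpace ℝ (Fin (d + 1))}
    (hy : ‖y‖ = 1) (k : ℕ) :
    2 * ∫ x : EuclideanSpace ℝ (Fin (d + 1)), (inner ℝ x y) ^ (k + 1) * Real.exp (-‖x‖ ^ 2) =
      k * ∫ x : EuclideanSpace ℝ (Fin (d + 1)), (inner ℝ x y) ^ (k - 1) * Real.exp (-‖x‖ ^ 2) := by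
  have hg : ∀ x : EuclideanSpace ℝ (Fin (d + 1)), HasLineDerivAt ℝ
      (fun x : EuclideanSpace ℝ (Fin (d + 1)) => (inner ℝ x y) ^ k * Real.exp (-‖x‖ ^ 2))
      (k * ((inner ℝ x y) ^ (k - 1) * Real.exp (-‖x‖ ^ 2))
        - 2 * ((inner ℝ x y) ^ (k + 1) * Real.exp (-‖x‖ ^ 2))) x y := by
    intro x
    have h1 : HasDerivAt (fun t : ℝ => x + t • y) y 0 := by
      have h0 := ((hasDerivAt_id (0 : ℝ)).smul_const y).const_add x
      rwa [one_smul] at h0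
    have h2 : HasDerivAt (fun t : ℝ => inner ℝ (x + t • y) y) 1 0 := by
      have h0 := h1.inner ℝ (hasDerivAt_const 0 y)
      simpa [hy] using h0
    have h3 : HasDerivAt (fun t : ℝ => ‖x + t • y‖ ^ 2) (2 * inner ℝ x y) 0 := by
      simpa using h1.norm_sq
    have h4 := (h2.pow k).mul h3.neg.exp
    refine h4.congr_deriv ?_
    simp
    ring
  have hint1 := (integrable_inner_pow_mul_gaussian y (k - 1)).const_mul (k : ℝ)
  have hint2 := (integrable_inner_pow_mul_gaussian y (k + 1)).const_mul (2 : ℝ)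
  -- Parts against the constant 1: the derivative along `y` of an integrable function integrates to
  -- zero. The truncated exponent `k - 1` at `k = 0` is harmless, being multiplied by `k`.
  have h := integral_bilinear_hasLineDerivAt_right_eq_neg_left_of_integrable
    (μ := (volume : Measure (EuclideanSpace ℝ (Fin (d + 1))))) (v := y)
    (f := fun _ => (1 : ℝ)) (f' := fun _ => (0 : ℝ))
    (g := fun x : EuclideanSpace ℝ (Fin (d + 1)) => (inner ℝ x y) ^ k * Real.exp (-‖x‖ ^ 2))
    (g' := fun x => k * ((inner ℝ x y) ^ (k - 1) * Real.exp (-‖x‖ ^ 2))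
        - 2 * ((inner ℝ x y) ^ (k + 1) * Real.exp (-‖x‖ ^ 2)))
    (B := ContinuousLinearMap.mul ℝ ℝ)
    (by simp) (by simpa [Pi.sub_def] using hint1.sub hint2)
    (by simpa using integrable_inner_pow_mul_gaussian y k)
    (fun x _ => by simpa [HasLineDerivAt] using hasDerivAt_const (0 : ℝ) (1 : ℝ))
    (fun x _ => hg x)
  simp only [ContinuousLinearMap.mul_apply', one_mul, zero_mul, integral_zero, neg_zero] at h
  rw [integral_sub hint1 hint2, integral_const_mul, integral_const_mul] at h
  linarith

/-- The moment recurrence of the zonal distribution on the sphere. -/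
theorem integral_inner_pow_succ {d : ℕ} (y : USphere d) (k : ℕ) :
    ((k : ℝ) + d) * ∫ u : USphere d, (inner ℝ (u : EuclideanSpace ℝ (Fin (d + 1)))
        (y : EuclideanSpace ℝ (Fin (d + 1)))) ^ (k + 1) ∂sphereSigma d =
      k * ∫ u : USphere d, (inner ℝ (u : EuclideanSpace ℝ (Fin (d + 1)))
        (y : EuclideanSpace ℝ (Fin (d + 1)))) ^ (k - 1) ∂sphereSigma d := by
  have hy : ‖(y : EuclideanSpace ℝ (Fin (d + 1)))‖ = 1 := by simp
  have h := two_mul_integral_inner_pow_succ_mul_gaussian hy k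
  rw [integral_inner_pow_mul_gaussian, integral_inner_pow_mul_gaussian] at h
  rw [sphereSigma, integral_smul_measure, integral_smul_measure, smul_eq_mul, smul_eq_mul,
    mul_left_comm, mul_left_comm (k : ℝ)]
  congr 1
  -- For `k = 0` the right side is zero and the first moment vanishes. Otherwise the two radial
  -- integrals differ by the factor (d + k)/2, `k` being the original index, and the 2 cancels.
  cases k with
  | zero =>
    have hpos : 0 < ∫ r in Ioi (0 : ℝ), r ^ (d + 1) * Real.exp (-r ^ 2) := by
      rw [integral_pow_mul_exp_neg_sq]
      have := Real.Gamma_pos_of_pos (s := (((d + 1 : ℕ) : ℝ) + 1) / 2) (by positivity)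
      positivity
    simp only [Nat.cast_zero, zero_mul, zero_add] at h ⊢
    rcases mul_eq_zero.1 h with h | h
    · norm_num at h
    · rcases mul_eq_zero.1 h with h | h
      · rw [h, mul_zero]
      · exact absurd h hpos.ne'
  | succ k =>
    have hpos : 0 < ∫ r in Ioi (0 : ℝ), r ^ (d + k) * Real.exp (-r ^ 2) := by
      rw [integral_pow_mul_exp_neg_sq]
      have := Real.Gamma_pos_of_pos (s := (((d + k : ℕ) : ℝ) + 1) / 2) (by positivity)
      positivity
    simp only [add_tsub_cancel_right] at h ⊢
    rw [show d + (k + 1 + 1) = d + k + 2 by ring, integral_pow_add_two_mul_exp_neg_sq] at h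
    apply mul_right_cancel₀ hpos.ne'
    push_cast at h ⊢
    linear_combination h

theorem continuous_eval_inner {d : ℕ} (p : Polynomial ℝ) (y : USphere d) :
    Continuous fun u : USphere d => p.eval (inner ℝ (u : EuclideanSpace ℝ (Fin (d + 1)))
      (y : EuclideanSpace ℝ (Fin (d + 1)))) :=
  p.continuous.comp (by fun_prop)

theorem integrable_of_continuous_sphere {d : ℕ} {μ : Measure (USphere d)} [IsFiniteMeasure μ]
    {f : USphere d → ℝ} (hf : Continuous f) : Integrable f μ :=
  hf.integrable_of_hasCompactSupport (HasCompactSupport.of_compactSpace f)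

open Polynomial in
/-- The zonal part of the Laplace-Beltrami operator integrates to zero. -/
theorem integral_zonal_laplacian {d : ℕ} (y : USphere d) (p : ℝ[X]) :
    ∫ u : USphere d, ((1 - X ^ 2) * derivative (derivative p) - C (d : ℝ) * X * derivative p).eval
      (inner ℝ (u : EuclideanSpace ℝ (Fin (d + 1))) (y : EuclideanSpace ℝ (Fin (d + 1))))
      ∂sphereSigma d = 0 := by
  induction p using Polynomial.induction_on' with
  | add p q hp hq =>
    have h := integral_add (μ := sphereSigma d)
      (integrable_of_continuous_sphere (continuous_eval_inner
        ((1 - X ^ 2) * derivative (derivative p) - C (d : ℝ) * X * derivative p) y))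
      (integrable_of_continuous_sphere (continuous_eval_inner
        ((1 - X ^ 2) * derivative (derivative q) - C (d : ℝ) * X * derivative q) y))
    rw [hp, hq, add_zero] at h
    rw [← h]
    refine integral_congr_ae (Filter.Eventually.of_forall fun u => ?_)
    simp only [← eval_add, derivative_add]
    congr 1
    ring
  | monomial n c =>
    cases n with
    | zero => simp
    | succ k =>
      -- On t^(k+1) the operator gives (k + 1)(k t^(k-1) - (k + d) t^(k+1)), so the moment
      -- recurrence is exactly the vanishing of its mean.
      have hrec := integral_inner_pow_succ y k
      have hi : ∀ j : ℕ, Integrable (fun u : USphere d =>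
          (inner ℝ (u : EuclideanSpace ℝ (Fin (d + 1)))
            (y : EuclideanSpace ℝ (Fin (d + 1)))) ^ j) (sphereSigma d) := fun j =>
        integrable_of_continuous_sphere (by fun_prop)
      have h := integral_sub (((hi (k - 1)).const_mul (k : ℝ)))
        ((hi (k + 1)).const_mul ((k : ℝ) + d))
      rw [integral_const_mul, integral_const_mul, hrec, sub_self] at h
      rw [← mul_zero (c * ((k : ℝ) + 1)), ← h, ← integral_const_mul]
      refine integral_congr_ae (Filter.Eventually.of_forall fun u => ?_)
      simp only [derivative_monomial, eval_sub, eval_mul, eval_one, eval_pow, eval_X, eval_C,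
        eval_monomial, add_tsub_cancel_right]
      cases k with
      | zero => simp; ring
      | succ k => simp only [add_tsub_cancel_right]; push_cast; ring

end SphericalMoments

/-! ### Zonal kernels: mean value and oscillation. -/

section JitteredSampling

open MeasureTheory Set

/-- The equation writes n(n + d - 1) P_n as minus the zonal Laplacian of P_n, and the eigenvalue is
nonzero for n ≥ 1. -/
theorem integral_genLegendre_inner {d : ℕ} (hd : 2 ≤ d) {n : ℕ} (hn : 1 ≤ n) (y : USphere d) :
    ∫ u : USphere d, (genLegendre d n).eval (inner ℝ (u : EuclideanSpace ℝ (Fin (d + 1)))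
      (y : EuclideanSpace ℝ (Fin (d + 1)))) ∂sphereSigma d = 0 := by
  have h := integral_zonal_laplacian y (genLegendre d n)
  rw [eq_neg_of_add_eq_zero_left (genLegendre_ode hd n)] at h
  simp only [Polynomial.eval_neg, Polynomial.eval_mul, Polynomial.eval_C, integral_neg,
    neg_eq_zero, integral_const_mul] at h
  exact (mul_eq_zero.1 h).resolve_left (genLegendre_eigenvalue_pos hd hn).ne'

theorem inner_mem_Icc {d : ℕ} (x y : USphere d) :
    inner ℝ (x : EuclideanSpace ℝ (Fin (d + 1))) (y : EuclideanSpace ℝ (Fin (d + 1))) ∈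
      Icc (-1 : ℝ) 1 := by
  have h := abs_real_inner_le_norm (x : EuclideanSpace ℝ (Fin (d + 1)))
    (y : EuclideanSpace ℝ (Fin (d + 1)))
  simp only [norm_eq_of_mem_sphere, mul_one] at h
  exact abs_le.1 h

theorem one_sub_inner_eq {d : ℕ} (x y : USphere d) :
    1 - inner ℝ (x : EuclideanSpace ℝ (Fin (d + 1))) (y : EuclideanSpace ℝ (Fin (d + 1))) =
      dist x y ^ 2 / 2 := by
  rw [Subtype.dist_eq, dist_eq_norm, norm_sub_sq_real]
  simp only [norm_eq_of_mem_sphere]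
  ring

theorem continuous_kernel {d : ℕ} {K : ℝ → ℝ} (hK : ContinuousOn K (Icc (-1) 1)) :
    Continuous fun p : USphere d × USphere d =>
      K (inner ℝ (p.1 : EuclideanSpace ℝ (Fin (d + 1)))
        (p.2 : EuclideanSpace ℝ (Fin (d + 1)))) :=
  hK.comp_continuous (by fun_prop) fun p => inner_mem_Icc p.1 p.2

/-- The point t = 1 suffices: there the partial sums are those of the nonnegative series Σ a_n
itself. -/
theorem summable_of_tendsto_genLegendre_sum {d : ℕ} (hd : 2 ≤ d) {a : ℕ → ℝ} {s : ℝ}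
    (ha : ∀ n, 0 ≤ a n)
    (h : Filter.Tendsto (fun m => ∑ n ∈ Finset.range m, a n * (genLegendre d n).eval 1)
      Filter.atTop (nhds s)) : Summable a := by
  simp only [genLegendre_eval_one hd, mul_one] at h
  exact ((hasSum_iff_tendsto_nat_of_nonneg ha s).2 h).summable

theorem summable_mul_genLegendre {d : ℕ} (hd : 2 ≤ d) {a : ℕ → ℝ} (ha : ∀ n, 0 ≤ a n)
    (hs : Summable a) {t : ℝ} (ht : t ∈ Icc (-1 : ℝ) 1) :
    Summable fun n => a n * (genLegendre d n).eval t := by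
  refine Summable.of_norm_bounded hs fun n => ?_
  rw [norm_mul, Real.norm_of_nonneg (ha n)]
  exact mul_le_of_le_one_right (ha n) (abs_genLegendre_eval_le_one hd n ht)

/-- The mean of a zonal kernel over the sphere is its zeroth coefficient. -/
theorem integral_kernel_eq {d : ℕ} (hd : 2 ≤ d) {a : ℕ → ℝ} {K : ℝ → ℝ} (ha : ∀ n, 0 ≤ a n)
    (hs : Summable a)
    (hK : ∀ t ∈ Icc (-1 : ℝ) 1, HasSum (fun n => a n * (genLegendre d n).eval t) (K t))
    (x : USphere d) :
    ∫ y : USphere d, K (inner ℝ (x : EuclideanSpace ℝ (Fin (d + 1)))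
      (y : EuclideanSpace ℝ (Fin (d + 1)))) ∂sphereSigma d = a 0 := by
  have h := hasSum_integral_of_dominated_convergence (μ := sphereSigma d)
    (F := fun n (y : USphere d) => a n * (genLegendre d n).eval
      (inner ℝ (y : EuclideanSpace ℝ (Fin (d + 1))) (x : EuclideanSpace ℝ (Fin (d + 1)))))
    (f := fun y : USphere d => K (inner ℝ (x : EuclideanSpace ℝ (Fin (d + 1)))
      (y : EuclideanSpace ℝ (Fin (d + 1))))) (fun n _ => a n)
    (fun n => (continuous_const.mul (continuous_eval_inner _ x)).aestronglyMeasurable)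
    (fun n => Filter.Eventually.of_forall fun y => by
      rw [norm_mul, Real.norm_of_nonneg (ha n)]
      exact mul_le_of_le_one_right (ha n) (abs_genLegendre_eval_le_one hd n (inner_mem_Icc y x)))
    (Filter.Eventually.of_forall fun _ => hs) (integrable_const _)
    (Filter.Eventually.of_forall fun y => by
      rw [real_inner_comm]
      exact hK _ (inner_mem_Icc x y))
  have h0 := hasSum_single (f := fun n => ∫ y : USphere d, a n * (genLegendre d n).eval
      (inner ℝ (y : EuclideanSpace ℝ (Fin (d + 1))) (x : EuclideanSpace ℝ (Fin (d + 1))))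
      ∂sphereSigma d) 0 fun n hn => by
    rw [integral_const_mul, integral_genLegendre_inner hd (Nat.one_le_iff_ne_zero.2 hn), mul_zero]
  rw [h.unique h0]
  simp [genLegendre]

/-- The oscillation of the kernel near the diagonal. -/
theorem kernel_one_sub_le {d : ℕ} (hd : 2 ≤ d) {a : ℕ → ℝ} {K : ℝ → ℝ} (ha : ∀ n, 0 ≤ a n)
    (hs : Summable a)
    (hK : ∀ t ∈ Icc (-1 : ℝ) 1, HasSum (fun n => a n * (genLegendre d n).eval t) (K t))
    {t δ : ℝ} (ht : t ∈ Icc (-1 : ℝ) 1) (htδ : 1 - t ≤ δ) (m : ℕ) :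
    K 1 - K t ≤ δ * ∑ n ∈ Finset.Icc 1 m, a n * (n : ℝ) ^ 2 + 2 * ∑' n, a (m + 1 + n) := by
  have h := (hK 1 (right_mem_Icc.2 (by norm_num))).sub (hK t ht)
  have hterm : ∀ n, a n * (genLegendre d n).eval 1 - a n * (genLegendre d n).eval t =
      a n * (1 - (genLegendre d n).eval t) := fun n => by
    rw [genLegendre_eval_one hd]; ring
  simp only [hterm] at h
  -- Cutting at `m + 1` keeps degrees 0, …, m in the finite sum; degree 0 then contributes nothing
  -- because P_0 = 1.
  rw [← h.tsum_eq, ← h.summable.sum_add_tsum_nat_add (m + 1)]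
  refine add_le_add ?_ ?_
  · rw [Finset.range_eq_Ico, Finset.sum_eq_sum_Ico_succ_bot (Nat.succ_pos m),
      Finset.mul_sum]
    simp only [genLegendre, Polynomial.eval_one, sub_self, mul_zero, zero_add]
    refine Finset.sum_le_sum fun n _ => ?_
    have h1 := one_sub_genLegendre_eval_le hd n ht
    calc a n * (1 - (genLegendre d n).eval t) ≤ a n * ((n : ℝ) ^ 2 * δ) := by
          have := ha n
          gcongr
          exact h1.trans (by gcongr)
      _ = δ * (a n * (n : ℝ) ^ 2) := by ring
  · have hs' : Summable fun n => a (m + 1 + n) := by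
      simpa [add_comm] using (summable_nat_add_iff (m + 1)).2 hs
    rw [← tsum_mul_left]
    have hq := (summable_nat_add_iff (f := fun n => a n * (1 - (genLegendre d n).eval t))
      (m + 1)).2 h.summable
    refine Summable.tsum_le_tsum (fun n => ?_) hq (hs'.mul_left 2)
    rw [add_comm n, mul_comm]
    have := (abs_le.1 (abs_genLegendre_eval_le_one hd (m + 1 + n) ht)).1
    exact mul_le_mul_of_nonneg_right (by linarith) (ha _)

/-! ### Area-regular partitions and the law of pairs of sample points. -/

variable {d N : ℕ} {A : Fin N → Set (USphere d)}

theorem IsAreaRegularPartition.pos (hA : IsAreaRegularPartition d N A) : 0 < N := by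
  rcases Nat.eq_zero_or_pos N with rfl | h
  · have h := congrArg (sphereSigma d) hA.covers
    simp at h
  · exact h

theorem IsAreaRegularPartition.isProbabilityMeasure (hA : IsAreaRegularPartition d N A)
    (i : Fin N) : IsProbabilityMeasure (regionMeasure d N (A i)) := by
  constructor
  rw [regionMeasure, Measure.smul_apply, Measure.restrict_apply_univ, hA.area, smul_eq_mul]
  exact ENNReal.mul_inv_cancel (by exact_mod_cast hA.pos.ne') (ENNReal.natCast_ne_top N)

theorem IsAreaRegularPartition.sum_integral (hA : IsAreaRegularPartition d N A)
    {f : USphere d → ℝ} (hf : Continuous f) :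
    ∑ i, ∫ x, f x ∂regionMeasure d N (A i) = N * ∫ x, f x ∂sphereSigma d := by
  have h := integral_iUnion_fintype (μ := sphereSigma d) (f := f) hA.measurable
    (fun i j hij => Set.disjoint_iff_inter_eq_empty.2 (hA.disjoint i j hij))
    (fun i => (integrable_of_continuous_sphere hf).integrableOn)
  rw [hA.covers, Measure.restrict_univ] at h
  rw [h, Finset.mul_sum]
  refine Finset.sum_congr rfl fun i _ => ?_
  rw [regionMeasure, integral_smul_measure, smul_eq_mul, ENNReal.toReal_natCast]

/-- Distinct coordinates of a product of probability measures are independent, so off-diagonal pairs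
produce no excess. -/
theorem IsAreaRegularPartition.map_eval_pair (hA : IsAreaRegularPartition d N A) {i j : Fin N}
    (hij : i ≠ j) :
    (jitteredLaw d N A).map (fun x => (x i, x j)) =
      (regionMeasure d N (A i)).prod (regionMeasure d N (A j)) := by
  have := hA.isProbabilityMeasure
  have h := (ProbabilityTheory.iIndepFun_pi (μ := fun i => regionMeasure d N (A i))
    (X := fun _ => id) fun _ => aemeasurable_id).indepFun hij
  simp only [id] at h
  rw [ProbabilityTheory.indepFun_iff_map_prod_eq_prod_map_map
    (measurable_pi_apply i).aemeasurable (measurable_pi_apply j).aemeasurable] at h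
  have he := fun i => (measurePreserving_eval (fun i => regionMeasure d N (A i)) i).map_eq
  exact h.trans (congrArg₂ Measure.prod (he i) (he j))

end JitteredSampling

/-! ### The mean energy of a jittered sample. -/

open MeasureTheory in
theorem theorem2 (d : ℕ) (hd : 2 ≤ d) (C : ℝ) (hC : 0 < C) :
    ∃ Cd : ℝ, 0 < Cd ∧
      ∀ (a : ℕ → ℝ) (K : ℝ → ℝ), (∀ n, 0 ≤ a n) → ContinuousOn K (Set.Icc (-1) 1) →
        (∀ t ∈ Set.Icc (-1 : ℝ) 1,
          Filter.Tendsto (fun m => ∑ n ∈ Finset.range m, a n * (genLegendre d n).eval t)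
            Filter.atTop (nhds (K t))) →
        ∀ (N : ℕ) (A : Fin N → Set (USphere d)), IsAreaRegularPartition d N A →
          (∀ i, Metric.diam (A i) ≤ C * (N : ℝ) ^ (-(1 / (d : ℝ)))) →
          Summable a ∧
          MeasureTheory.Integrable (energy d N K) (jitteredLaw d N A) ∧
          (∫ x, energy d N K x ∂(jitteredLaw d N A)) - a 0 ≤
            Cd / N *
              ((N : ℝ) ^ (-(2 / (d : ℝ))) *
                  ∑ n ∈ Finset.Icc 1 ⌊(N : ℝ) ^ (1 / (d : ℝ))⌋₊, a n * (n : ℝ) ^ 2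
                + ∑' n : ℕ, a (⌊(N : ℝ) ^ (1 / (d : ℝ))⌋₊ + 1 + n)) := by
  -- C²/2 comes from 1 - ⟨x, y⟩ = |x - y|²/2 and 2 from 1 - P_n ≤ 2; the dimension does not enter.
  refine ⟨C ^ 2 / 2 + 2, by positivity, fun a K ha hKc hlim N A hA hdiam => ?_⟩
  have hs : Summable a :=
    summable_of_tendsto_genLegendre_sum hd ha (hlim 1 (Set.right_mem_Icc.2 (by norm_num)))
  have hK : ∀ t ∈ Set.Icc (-1 : ℝ) 1, HasSum (fun n => a n * (genLegendre d n).eval t) (K t) :=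
    fun t ht => by
      have h := (summable_mul_genLegendre hd ha hs ht).hasSum
      rwa [tendsto_nhds_unique h.tendsto_sum_nat (hlim t ht)] at h
  have hprob := hA.isProbabilityMeasure
  have : IsProbabilityMeasure (jitteredLaw d N A) := by
    unfold jitteredLaw; infer_instance
  have hN : (0 : ℝ) < N := by exact_mod_cast hA.pos
  set m := ⌊(N : ℝ) ^ (1 / (d : ℝ))⌋₊
  set S := ∑ n ∈ Finset.Icc 1 m, a n * (n : ℝ) ^ 2
  set T := ∑' n : ℕ, a (m + 1 + n)
  have hS0 : 0 ≤ S := Finset.sum_nonneg fun n _ => mul_nonneg (ha n) (sq_nonneg _)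
  have hT0 : 0 ≤ T := tsum_nonneg fun n => ha _
  set k : USphere d × USphere d → ℝ := fun p =>
    K (inner ℝ (p.1 : EuclideanSpace ℝ (Fin (d + 1))) (p.2 : EuclideanSpace ℝ (Fin (d + 1))))
    with hk
  have hkc : Continuous k := continuous_kernel hKc
  have hkint : ∀ i j, Integrable (fun x : Fin N → USphere d => k (x i, x j))
      (jitteredLaw d N A) := fun i j =>
    Continuous.integrable_of_hasCompactSupport (by fun_prop) (HasCompactSupport.of_compactSpace _)
  have henergy : energy d N K = fun x => 1 / (N : ℝ) ^ 2 * ∑ i, ∑ j, k (x i, x j) := rfl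
  have hsum : ∀ i, Integrable (fun x : Fin N → USphere d => ∑ j, k (x i, x j))
      (jitteredLaw d N A) := fun i => integrable_finsetSum _ fun j _ => hkint i j
  refine ⟨hs, henergy ▸ (integrable_finsetSum _ fun i _ => hsum i).const_mul _, ?_⟩
  set δ := C ^ 2 / 2 * (N : ℝ) ^ (-(2 / (d : ℝ))) with hδ
  set B := δ * S + 2 * T with hB
  have hdiag : ∀ i, ∀ x ∈ A i, ∀ y ∈ A i, K 1 ≤ k (x, y) + B := by
    intro i x hx y hy
    -- Compactness of the sphere excludes the default value 0 of `Metric.diam` on unbounded sets.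
    have h1 := Metric.dist_le_diam_of_mem (Metric.isBounded_of_compactSpace (s := A i)) hx hy
    have h2 : dist x y ^ 2 ≤ (C * (N : ℝ) ^ (-(1 / (d : ℝ)))) ^ 2 :=
      pow_le_pow_left₀ dist_nonneg (h1.trans (hdiam i)) 2
    rw [mul_pow, ← Real.rpow_natCast ((N : ℝ) ^ (-(1 / (d : ℝ)))), ← Real.rpow_mul hN.le,
      show -(1 / (d : ℝ)) * (2 : ℕ) = -(2 / (d : ℝ)) by push_cast; ring] at h2
    have h3 := kernel_one_sub_le hd ha hs hK (inner_mem_Icc x y) (δ := δ)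
      (by rw [one_sub_inner_eq, hδ]; linarith) m
    linarith
  -- Off the diagonal this is an equality; on it, K(1) is compared with the average of `k + B` over
  -- A_i × A_i.
  have hpair : ∀ i j, ∫ x, k (x i, x j) ∂jitteredLaw d N A ≤
      (∫ x, ∫ y, k (x, y) ∂regionMeasure d N (A j) ∂regionMeasure d N (A i)) +
        if i = j then B else 0 := by
    intro i j
    have hkp : Integrable k ((regionMeasure d N (A i)).prod (regionMeasure d N (A j))) :=
      hkc.integrable_of_hasCompactSupport (HasCompactSupport.of_compactSpace _)
    rw [← integral_prod _ hkp]
    by_cases hij : i = j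
    · subst hij
      rw [if_pos rfl]
      have hmem : ∀ᵐ x ∂regionMeasure d N (A i), x ∈ A i :=
        Measure.ae_smul_measure (ae_restrict_mem (hA.measurable i)) _
      have h1 : ∀ x : Fin N → USphere d, k (x i, x i) = K 1 := fun x => by
        simp [hk]
      simp only [h1, integral_const, probReal_univ, one_smul]
      have h2 : ∫ _p, K 1 ∂((regionMeasure d N (A i)).prod (regionMeasure d N (A i))) ≤
          ∫ p, (k p + B) ∂((regionMeasure d N (A i)).prod (regionMeasure d N (A i))) := by
        refine integral_mono_ae (integrable_const _) (hkp.add (integrable_const _)) ?_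
        filter_upwards [Measure.quasiMeasurePreserving_fst.ae hmem,
          Measure.quasiMeasurePreserving_snd.ae hmem] with p hp1 hp2
        exact hdiag i p.1 hp1 p.2 hp2
      rw [integral_add hkp (integrable_const _)] at h2
      simpa using h2
    · rw [if_neg hij, add_zero, ← hA.map_eval_pair hij,
        integral_map (by fun_prop) hkc.aestronglyMeasurable]
  -- Summing over `j` first reassembles N σ, and the mean of K(⟨x, ·⟩) is a_0 for every `x`.
  have htotal : ∑ i, ∑ j, (∫ x, ∫ y, k (x, y) ∂regionMeasure d N (A j) ∂regionMeasure d N (A i)) =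
      (N : ℝ) ^ 2 * a 0 := by
    have hrow : ∀ i,
        ∑ j, (∫ x, ∫ y, k (x, y) ∂regionMeasure d N (A j) ∂regionMeasure d N (A i)) =
          N * a 0 := by
      intro i
      rw [← integral_finsetSum]
      · have : ∀ x, ∑ j, ∫ y, k (x, y) ∂regionMeasure d N (A j) = N * a 0 := fun x => by
          rw [hA.sum_integral (by fun_prop : Continuous fun y => k (x, y)),
            integral_kernel_eq hd ha hs hK x]
        simp [this]
      · intro j _
        exact (hkc.integrable_of_hasCompactSupport
          (HasCompactSupport.of_compactSpace _)).integral_prod_left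
    simp only [hrow, Finset.sum_const, Finset.card_univ, Fintype.card_fin, nsmul_eq_mul]
    ring
  have hle : ∑ i, ∑ j, ∫ x, k (x i, x j) ∂jitteredLaw d N A ≤ (N : ℝ) ^ 2 * a 0 + N * B := by
    refine (Finset.sum_le_sum fun i _ => Finset.sum_le_sum fun j _ => hpair i j).trans_eq ?_
    simp only [Finset.sum_add_distrib, htotal]
    simp
  rw [henergy, integral_const_mul, integral_finsetSum _ fun i _ => hsum i]
  simp only [integral_finsetSum _ fun j _ => hkint _ j]
  calc 1 / (N : ℝ) ^ 2 * (∑ i, ∑ j, ∫ x, k (x i, x j) ∂jitteredLaw d N A) - a 0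
      ≤ 1 / (N : ℝ) ^ 2 * ((N : ℝ) ^ 2 * a 0 + N * B) - a 0 := by gcongr
    _ = 1 / N * B := by field_simp; ring
    _ ≤ 1 / N * ((C ^ 2 / 2 + 2) * ((N : ℝ) ^ (-(2 / (d : ℝ))) * S + T)) := by
        have h1 : 0 ≤ (N : ℝ) ^ (-(2 / (d : ℝ))) * S := by positivity
        have h2 : 0 ≤ C ^ 2 / 2 * T := by positivity
        gcongr
        rw [hB, hδ]
        linarith
    _ = _ := by ring
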